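/- Let $n\ge 1$ and let $X=\Gamma\backslash\mathbb{B}^n$ be the quotient of the complex $n$-ball by a torsion-free lattice $\Gamma\subset \mathrm{PU}(n,1)$ all of whose parabolic elements are unipotent. Here $\mathrm{PU}(n,1)$ is the projective unitary group of the Hermitian form $z^*J_0z$ on $\mathbb{C}^{n+1}$, where $J_0$ exchanges the first and the last coordinate and is the identity on the others, and $\mathbb{B}^n$ is the set of negative lines of this form, identified with the Siegel domain $\{(\zeta,v,u)\in\mathbb{C}^{n-1}\times\mathbb{R}\times\mathbb{R}: u>0\}$ by $(\zeta,v,u)\mapsto[\tfrac12(-\|\zeta\|^2-u+iv):\zeta:1]$; the point $q_\infty=[1:0:\dots:0]$ lies on the boundary. *Systole.* Let $d(\cdot,\cdot)$ be the distance of the Bergman metric on $\mathbb{B}^n$, normalized to have holomorphic sectional curvature $-1$, i.e. $\cosh^2\big(d(z,w)/2\big)=\frac{|\langle z,w\rangle|^2}{\langle z,z\rangle\langle w,w\rangle}$. An element of $\mathrm{PU}(n,1)$ is hyperbolic if it has exactly two fixed points in the closed ball, both on the boundary, and parabolic if it has a unique fixed point in the closed ball, which lies on the boundary. Let $\mathrm{sys}(X)$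 be the infimum of the lengths $\ell(\gamma)=\inf_{z\in\mathbb{B}^n}d(z,\gamma z)$ of the hyperbolic $\gamma\in\Gamma$. *Uniform depth.* For a fixed point $q_i$ of a parabolic element of $\Gamma$ choose $g\in\mathrm{PU}(n,1)$ with $g q_i=q_\infty$; let $\Gamma_i$ be the stabilizer of $q_i$ in $\Gamma$ and let $B_i(\tilde u)=g^{-1}\{u>\tilde u\}$. Let $t_i>0$ be the length of the shortest vertical translation $(\zeta,v,u)\mapsto(\zeta,v+t,u)$, $t>0$, in $g\Gamma g^{-1}$, let $u_i$ be the smallest $\tilde u>0$ such that $\Gamma_i\backslash B_i(\tilde u)\to X$ is injective, and let $d_i=t_i/u_i$ be the depth of the cusp; $d_i$ and the horoballs $B_i(t_i/d)$ do not depend on $g$. The uniform depth $d$ of the cusps of $X$ is the largest $d>0$ such that $d\le d_i$ for all $i$ and such that the images in $X$ of the horoballs $B_i(t_i/d)$ at different cusps (that is, at $\Gamma$-inequivalent parabolic fixed points) are disjoint. **Theorem.** Let $d$ be the uniform depth of the cusps of $X$, and let $s'=\sqrt2\,e^{\mathrm{sys}(X)/4}$. If $s'\ge 2n$, then $$d\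 \ge\ \min\big\{(s'-2n)^{1/4},\ (s'-2n)^{1/2}\big\}.$$ In particular, if $\mathrm{sys}(X)\ge 4\ln\big(5n+(4\pi)^4\big)$, then $d>e^{\mathrm{sys}(X)/16}>4\pi$. -/

import Mathlib

open Matrix
open scoped LinearAlgebra.Projectivization

noncomputable section

namespace CHyp

/-! ### The Hermitian form and the group `PU(n,1)` -/

/-- The matrix `J₀` of the Hermitian form of signature `(n,1)`: coordinates `0` and `n` are swapped,
the remaining `n - 1` coordinates carry the identity matrix. -/
def J (n : ℕ) : Matrix (Fin (n + 1)) (Fin (n + 1)) ℂ :=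
  (Equiv.swap 0 (Fin.last n)).permMatrix ℂ

/-- The Hermitian form `z* J₀ w`. -/
def form (n : ℕ) (z w : Fin (n + 1) → ℂ) : ℂ := star z ⬝ᵥ (J n *ᵥ w)

/-- The (real) value `z* J₀ z`. -/
def Q (n : ℕ) (z : Fin (n + 1) → ℂ) : ℝ := (form n z z).re

/-- The unitary group of the form `J₀`, i.e. `U(n,1)`. -/
def U (n : ℕ) : Subgroup (GL (Fin (n + 1)) ℂ) where
  carrier := {g | (g : Matrix _ _ ℂ)ᴴ * J n * (g : Matrix _ _ ℂ) = J n}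
  one_mem' := by simp
  mul_mem' := by
    intro a b ha hb
    simp only [Set.mem_ofPred_eq, Units.val_mul, conjTranspose_mul] at ha hb ⊢
    calc _ = (b : Matrix _ _ ℂ)ᴴ * ((a : Matrix _ _ ℂ)ᴴ * J n * (a : Matrix _ _ ℂ)) *
          (b : Matrix _ _ ℂ) := by simp only [Matrix.mul_assoc]
      _ = J n := by rw [ha, hb]
  inv_mem' := by
    intro a ha
    simp only [Set.mem_ofPred_eq] at ha ⊢
    have h1 : a.val * (a⁻¹).val = 1 := by
      rw [← Units.val_mul, mul_inv_cancel, Units.val_one]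
    have h2 : (a⁻¹).valᴴ * a.valᴴ = 1 := by
      rw [← conjTranspose_mul, h1, conjTranspose_one]
    calc _ = (a⁻¹).valᴴ * (a.valᴴ * J n * a.val) * (a⁻¹).val := by rw [ha]
      _ = ((a⁻¹).valᴴ * a.valᴴ) * J n * (a.val * (a⁻¹).val) := by simp only [Matrix.mul_assoc]
      _ = J n := by rw [h1, h2, Matrix.one_mul, Matrix.mul_one]

/-- The matrix underlying an element of `U(n,1)`. -/
abbrev mat {n : ℕ} (g : U n) : Matrix (Fin (n + 1)) (Fin (n + 1)) ℂ :=
  ((g : GL (Fin (n + 1)) ℂ) : Matrix _ _ ℂ)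

theorem mat_mul_inv {n : ℕ} (g : U n) : mat g * mat g⁻¹ = 1 := by
  have h : mat g * mat g⁻¹ = mat (g * g⁻¹) := rfl
  rw [h, mul_inv_cancel]
  rfl

/-- The subgroup of scalar matrices `μ I` in `U(n,1)` (automatically `|μ| = 1`), its centre. -/
def scalars (n : ℕ) : Subgroup (U n) where
  carrier := {g | ∃ μ : ℂ, mat g = μ • (1 : Matrix _ _ ℂ)}
  one_mem' := ⟨1, by simp⟩
  mul_mem' := by
    rintro a b ⟨μ, hμ⟩ ⟨ν, hν⟩
    refine ⟨μ * ν, ?_⟩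
    have h : mat (a * b) = mat a * mat b := rfl
    rw [h, hμ, hν, smul_mul_assoc, Matrix.one_mul, smul_smul]
  inv_mem' := by
    rintro a ⟨μ, hμ⟩
    have h1 : mat a * mat a⁻¹ = 1 := mat_mul_inv a
    rw [hμ, smul_mul_assoc, Matrix.one_mul] at h1
    have hμ0 : μ ≠ 0 := by
      rintro rfl
      simp at h1
    exact ⟨μ⁻¹, by rw [← h1, smul_smul, inv_mul_cancel₀ hμ0, one_smul]⟩

instance (n : ℕ) : (scalars n).Normal where
  conj_mem := by
    rintro a ⟨μ, hμ⟩ g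
    refine ⟨μ, ?_⟩
    have h1 : mat g * mat g⁻¹ = 1 := mat_mul_inv g
    have h2 : mat (g * a * g⁻¹) = mat g * mat a * mat g⁻¹ := rfl
    rw [h2, hμ, mul_smul_comm, Matrix.mul_one, smul_mul_assoc, h1]

/-- The projective unitary group `PU(n,1)`, with the quotient topology. -/
abbrev PU (n : ℕ) : Type := U n ⧸ scalars n

/-! ### The action on projective space -/

/-- The projective space `ℙ(ℂ^{n,1})`. -/
abbrev Proj (n : ℕ) : Type := ℙ ℂ (Fin (n + 1) → ℂ)

theorem U_smul_mk {n : ℕ} (g : U n) (z : Fin (n + 1) → ℂ) (hz : z ≠ 0)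
    (hgz : mat g *ᵥ z ≠ 0) :
    g • (Projectivization.mk ℂ z hz : Proj n) = Projectivization.mk ℂ (mat g *ᵥ z) hgz := rfl

theorem scalars_smul {n : ℕ} {g : U n} (hg : g ∈ scalars n) (p : Proj n) : g • p = p := by
  obtain ⟨μ, hμ⟩ := hg
  induction p using Projectivization.ind with
  | h v hv =>
    change (g : GL (Fin (n + 1)) ℂ) • Projectivization.mk ℂ v hv = _
    rw [Projectivization.smul_mk, Projectivization.mk_eq_mk_iff']
    refine ⟨μ, ?_⟩
    change μ • v = mat g *ᵥ v
    rw [hμ, smul_mulVec, one_mulVec]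

/-- `PU(n,1)` acts on projective space by matrix multiplication. -/
instance (n : ℕ) : MulAction (PU n) (Proj n) :=
  MulAction.compHom (Proj n)
    (QuotientGroup.lift (scalars n) (MulAction.toPermHom (U n) (Proj n)) (by
      intro g hg
      ext p
      exact scalars_smul hg p))

theorem PU_mk_smul {n : ℕ} (g : U n) (p : Proj n) : (QuotientGroup.mk g : PU n) • p = g • p := rfl

/-! ### Complex hyperbolic space, its boundary and the Bergman metric

The ball `𝔹ⁿ` is realized as the set of negative lines of the form `J₀`, which the map
`ψ(ζ, v, u) = [(-‖ζ‖² - u + i v) / 2 : ζ : 1]` identifies with the Siegel domain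
`{(ζ, v, u) | u > 0}`; its boundary sphere is the set of isotropic lines. -/

/-- The ball `𝔹ⁿ`: negative lines. -/
def ball (n : ℕ) : Set (Proj n) := {p | Q n p.rep < 0}

/-- The boundary sphere `∂𝔹ⁿ`: isotropic lines. -/
def boundary (n : ℕ) : Set (Proj n) := {p | Q n p.rep = 0}

/-- The closed ball. -/
def closedBall (n : ℕ) : Set (Proj n) := ball n ∪ boundary n

/-- The distance of the Bergman metric on the ball, normalized to have holomorphic sectional
curvature `-1`: `cosh² (d(z,w)/2) = |⟨z,w⟩|² / (⟨z,z⟩ ⟨w,w⟩)`. -/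
def bergmanDist {n : ℕ} (p q : Proj n) : ℝ :=
  2 * Real.arcosh (‖form n p.rep q.rep‖ / √(Q n p.rep * Q n q.rep))

/-! ### Classification of isometries, the systole -/

/-- `γ` is parabolic: it has a unique fixed point in the closed ball, and that fixed point lies on
the boundary. -/
def IsParabolic {n : ℕ} (γ : PU n) : Prop :=
  ∃ p ∈ boundary n, {q ∈ closedBall n | γ • q = q} = {p}

/-- `γ` is hyperbolic: it has exactly two fixed points in the closed ball, both on the boundary. -/
def IsHyperbolic {n : ℕ} (γ : PU n) : Prop :=
  ∃ p ∈ boundary n, ∃ q ∈ boundary n, p ≠ q ∧ {r ∈ closedBall n | γ • r = r} = {p, q}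

/-- `γ` is unipotent: it is represented by a unipotent matrix. -/
def IsUnipotent {n : ℕ} (γ : PU n) : Prop :=
  ∃ g : U n, (QuotientGroup.mk g : PU n) = γ ∧ IsNilpotent (mat g - 1)

/-- The length `ℓ(γ) = inf_z d(z, γ z)`. -/
def length {n : ℕ} (γ : PU n) : ℝ :=
  sInf ((fun z : Proj n => bergmanDist z (γ • z)) '' ball n)

/-- The systole of `Γ \ 𝔹ⁿ`: the infimum of the lengths of the hyperbolic elements of `Γ`. -/
def systole {n : ℕ} (Γ : Subgroup (PU n)) : ℝ :=
  sInf {l : ℝ | ∃ γ ∈ Γ, IsHyperbolic γ ∧ l = length γ}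

/-! ### Lattices -/

/-- `Γ` is a lattice: it is discrete and `PU(n,1) / Γ` carries a nonzero finite Borel measure
invariant under `PU(n,1)`. -/
def IsLattice {n : ℕ} (Γ : Subgroup (PU n)) : Prop :=
  DiscreteTopology Γ ∧
    ∃ μ : @MeasureTheory.Measure (PU n ⧸ Γ) (borel (PU n ⧸ Γ)),
      μ ≠ 0 ∧ μ Set.univ < ⊤ ∧
      ∀ (g : PU n) (s : Set (PU n ⧸ Γ)), @MeasurableSet _ (borel (PU n ⧸ Γ)) s →
        μ ((fun x => g • x) ⁻¹' s) = μ s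

/-- No element of `Γ` other than `1` has finite order. -/
def IsTorsionFree {n : ℕ} (Γ : Subgroup (PU n)) : Prop :=
  ∀ γ ∈ Γ, IsOfFinOrder γ → γ = 1

/-! ### Cusps, horoballs, heights and depths -/

/-- The point `q_∞ = [1 : 0 : ⋯ : 0]`. -/
def qInf (n : ℕ) : Proj n :=
  Projectivization.mk ℂ (Pi.single 0 1) (by simp)

/-- The coordinate `u` of the point `p = ψ(ζ, v, u)` of the Siegel domain: if `z` is any
representative of `p`, then `u = -⟨z,z⟩ / |z_n|²`. -/
def heightCoord {n : ℕ} (p : Proj n) : ℝ := -Q n p.rep / ‖p.rep (Fin.last n)‖ ^ 2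

/-- The horoball `B_∞(u₀) = {u > u₀}` centred at `q_∞` of height `u₀`. -/
def horoball (n : ℕ) (u₀ : ℝ) : Set (Proj n) := {p ∈ ball n | u₀ < heightCoord p}

/-- `g ∈ PU(n,1)` is the vertical translation `(ζ, v, u) ↦ (ζ, v + t, u)`; its matrix is
`I + (i t / 2) E_{0,n}`. -/
def IsVerticalTranslation {n : ℕ} (t : ℝ) (g : PU n) : Prop :=
  ∃ h : U n, (QuotientGroup.mk h : PU n) = g ∧
    mat h = Matrix.transvection 0 (Fin.last n) (Complex.I * t / 2)

/-- The conjugate `g Γ g⁻¹`. -/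
def conj {n : ℕ} (g : PU n) (Γ : Subgroup (PU n)) : Subgroup (PU n) :=
  Γ.map (MulAut.conj g).toMonoidHom

/-- The length of the shortest vertical translation in `Γ` (based at `q_∞`). -/
def shortestVertical {n : ℕ} (Γ : Subgroup (PU n)) : ℝ :=
  sInf {t : ℝ | 0 < t ∧ ∃ γ ∈ Γ, IsVerticalTranslation t γ}

/-- `Γ_∞ \ B → Γ \ 𝔹ⁿ` is injective, where `Γ_∞` is the stabilizer of `q_∞` in `Γ`: two points of
`B` in the same `Γ`-orbit are in the same `Γ_∞`-orbit. -/
def Injects {n : ℕ} (Γ : Subgroup (PU n)) (B : Set (Proj n)) : Prop :=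
  ∀ x ∈ B, ∀ y ∈ B, (∃ γ ∈ Γ, γ • x = y) → ∃ γ ∈ Γ, γ • qInf n = qInf n ∧ γ • x = y

/-- The height of the cusp `q_∞` of `Γ`: the smallest `u₀` such that `Γ_∞ \ B_∞(u₀)` injects into
`Γ \ 𝔹ⁿ`. -/
def cuspHeight {n : ℕ} (Γ : Subgroup (PU n)) : ℝ :=
  sInf {u₀ : ℝ | 0 < u₀ ∧ Injects Γ (horoball n u₀)}

/-- The depth `t / u` of the cusp `q_∞` of `Γ`. -/
def cuspDepth {n : ℕ} (Γ : Subgroup (PU n)) : ℝ := shortestVertical Γ / cuspHeight Γ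

/-- `p` is a parabolic fixed point of `Γ`; the cusps of `Γ \ 𝔹ⁿ` are the `Γ`-orbits of these. -/
def IsCuspPoint {n : ℕ} (Γ : Subgroup (PU n)) (p : Proj n) : Prop :=
  p ∈ boundary n ∧ ∃ γ ∈ Γ, IsParabolic γ ∧ γ • p = p

/-- `g` carries a cusp `g⁻¹ q_∞` of `Γ` to `q_∞`. Heights and vertical translations at that cusp are
those of `g Γ g⁻¹` at `q_∞`; the depth and the horoball of height `t / d` below do not depend on the
choice of `g` for a given cusp. -/
def IsCuspChart {n : ℕ} (Γ : Subgroup (PU n)) (g : PU n) : Prop :=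
  IsCuspPoint Γ (g⁻¹ • qInf n)

/-- The horoball of height `t / d` at the cusp `g⁻¹ q_∞`, where `t` is the length of the shortest
vertical translation of `Γ` at that cusp. -/
def cuspHoroball {n : ℕ} (Γ : Subgroup (PU n)) (g : PU n) (d : ℝ) : Set (Proj n) :=
  (fun x => g⁻¹ • x) '' horoball n (shortestVertical (conj g Γ) / d)

/-- `d` is at most the depth of every cusp, and the horoballs of height `t / d` at different cusps
have disjoint images in `Γ \ 𝔹ⁿ`. -/
def IsAdmissibleDepth {n : ℕ} (Γ : Subgroup (PU n)) (d : ℝ) : Prop :=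
  0 < d ∧
  (∀ g : PU n, IsCuspChart Γ g → d ≤ cuspDepth (conj g Γ)) ∧
  ∀ g h : PU n, IsCuspChart Γ g → IsCuspChart Γ h →
    (∀ γ ∈ Γ, γ • (g⁻¹ • qInf n) ≠ h⁻¹ • qInf n) →
    ∀ x ∈ cuspHoroball Γ g d, ∀ y ∈ cuspHoroball Γ h d, ∀ γ ∈ Γ, γ • x ≠ y

/-- `d` is the uniform depth of the cusps of `Γ \ 𝔹ⁿ`: the largest admissible depth. -/
def IsUniformDepth {n : ℕ} (Γ : Subgroup (PU n)) (d : ℝ) : Prop :=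
  IsGreatest {d : ℝ | IsAdmissibleDepth Γ d} d

end CHyp

end

/-!
Let `p` and `q` be isotropic vectors on two distinct boundary lines, fixed by the unipotent maps
`v ↦ v + i a ⟨p, v⟩ p` and `v ↦ v + i b ⟨q, v⟩ q` with `a, b > 0`. The product of the first with the
inverse of the second preserves the plane spanned by `p` and `q`, where it has determinant `1` and
trace `2 + a b |⟨p, q⟩|² > 2`, and it is the identity on the positive definite orthogonal complement
of this plane. So it is hyperbolic, and its length `ℓ` satisfies
`2 cosh (ℓ / 2) = 2 + a b |⟨p, q⟩|²` (of which `isHyperbolic_and_length_le` proves the upper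
bound for `ℓ`, the one that matters).

Vertical translations by `t₁` and `t₂` at two parabolic fixed points of `Γ`, the second possibly the
image of the first under an element of `Γ`, are of this form with `a b = t₁ t₂ / 4`. Hence
`e^(sys / 2) - 2 ≤ t₁ t₂ |⟨p, q⟩|² / 4`. The horoballs of heights `u₁` and `u₂` at the two points
are disjoint as soon as `u₁ u₂ |⟨p, q⟩|² ≥ 4`, by the reversed Cauchy–Schwarz inequality applied to a
combination of `p` and `q` (`norm_Q_mul_norm_form_le`). With `uᵢ = tᵢ / D` this holds whenever
`D² ≤ e^(sys / 2) - 2` (`not_smul_eq_of_mem_horoball`), so that every such `D` is at most the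
uniform depth (`isAdmissibleDepth_of_sq_le`). Since `e^(sys / 2) = s'² / 2` and
`s'² / 2 - 2 ≥ s' - 2 n ≥ 0` for `s' ≥ 2 n`, the number
`D = min ((s' - 2 n)^(1/4)) ((s' - 2 n)^(1/2))` is one of them when it is positive.
-/

namespace CHyp

/-! ### The Hermitian form -/

section Form

variable {n : ℕ}

/-- The form is the standard Hermitian product minus a rank one form; this exhibits its signature
`(n,1)` without a change of basis. -/
theorem form_eq_dotProduct_sub (z w : Fin (n + 1) → ℂ) :
    form n z w = star z ⬝ᵥ w - star (z 0 - z (Fin.last n)) * (w 0 - w (Fin.last n)) := by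
  have hJ : J n *ᵥ w = w - (w 0 - w (Fin.last n)) •
      (Pi.single 0 1 - Pi.single (Fin.last n) 1 : Fin (n + 1) → ℂ) := by
    ext i
    simp only [J, permMatrix_mulVec, Function.comp, Pi.sub_apply, Pi.smul_apply, smul_eq_mul,
      Pi.single_apply]
    rcases eq_or_ne i 0 with rfl | h0
    · rcases eq_or_ne (0 : Fin (n + 1)) (Fin.last n) with h | h
      · simp [← h]
      · simp [h]
    · rcases eq_or_ne i (Fin.last n) with rfl | h1
      · simp [h0]
      · simp [h0, h1, Equiv.swap_apply_of_ne_of_ne h0 h1]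
  rw [form, hJ, dotProduct_sub, dotProduct_smul, dotProduct_sub]
  simp only [dotProduct_single, Pi.star_apply, smul_eq_mul, star_sub]
  ring

theorem form_add_left (x y z : Fin (n + 1) → ℂ) : form n (x + y) z = form n x z + form n y z := by
  simp [form, add_dotProduct]

theorem form_add_right (x y z : Fin (n + 1) → ℂ) : form n x (y + z) = form n x y + form n x z := by
  simp [form, mulVec_add, dotProduct_add]

theorem form_smul_left (c : ℂ) (x y : Fin (n + 1) → ℂ) :
    form n (c • x) y = star c * form n x y := by
  simp [form, star_smul, smul_dotProduct]

theorem form_smul_right (c : ℂ) (x y : Fin (n + 1) → ℂ) :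
    form n x (c • y) = c * form n x y := by
  simp [form, mulVec_smul, dotProduct_smul]

theorem star_form (x y : Fin (n + 1) → ℂ) : star (form n x y) = form n y x := by
  rw [form_eq_dotProduct_sub, form_eq_dotProduct_sub, star_sub, star_mul', star_star,
    star_dotProduct, star_star, mul_comm (star _), dotProduct_comm]

theorem norm_form_comm (x y : Fin (n + 1) → ℂ) : ‖form n x y‖ = ‖form n y x‖ := by
  rw [← star_form, norm_star]

theorem form_self (z : Fin (n + 1) → ℂ) : form n z z = (Q n z : ℂ) :=
  (Complex.conj_eq_iff_re.1 (star_form z z)).symm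

theorem Q_smul (c : ℂ) (z : Fin (n + 1) → ℂ) : Q n (c • z) = ‖c‖ ^ 2 * Q n z := by
  have h : form n (c • z) (c • z) = ((‖c‖ ^ 2 * Q n z : ℝ) : ℂ) := by
    rw [form_smul_left, form_smul_right, form_self]
    push_cast
    rw [← Complex.mul_conj' c, starRingEnd_apply]
    ring
  rw [Q, h, Complex.ofReal_re]

theorem Q_add (x y : Fin (n + 1) → ℂ) : Q n (x + y) = Q n x + Q n y + 2 * (form n x y).re := by
  have h : (form n y x).re = (form n x y).re := by rw [← star_form x y]; simp
  simp only [Q, form_add_left, form_add_right, Complex.add_re, h]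
  ring

theorem Q_eq_sum_sub (z : Fin (n + 1) → ℂ) :
    Q n z = ∑ i, ‖z i‖ ^ 2 - ‖z 0 - z (Fin.last n)‖ ^ 2 := by
  have h : form n z z = ((∑ i, ‖z i‖ ^ 2 - ‖z 0 - z (Fin.last n)‖ ^ 2 : ℝ) : ℂ) := by
    rw [form_eq_dotProduct_sub, dotProduct]
    push_cast
    simp only [← Complex.conj_mul', Pi.star_apply, starRingEnd_apply]
  rw [Q, h, Complex.ofReal_re]

theorem eq_zero_of_sum_norm_sq_le {z : Fin (n + 1) → ℂ} (h : ∑ i, ‖z i‖ ^ 2 ≤ 0) : z = 0 := by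
  have h0 := (Finset.sum_eq_zero_iff_of_nonneg (fun i _ => sq_nonneg ‖z i‖)).1
    (le_antisymm h (Finset.sum_nonneg fun i _ => sq_nonneg ‖z i‖))
  ext i
  simpa using h0 i (Finset.mem_univ i)

theorem norm_sq_star_dotProduct_le (v w : Fin (n + 1) → ℂ) :
    ‖star v ⬝ᵥ w‖ ^ 2 ≤ (∑ i, ‖v i‖ ^ 2) * ∑ i, ‖w i‖ ^ 2 := by
  have h := norm_inner_le_norm (𝕜 := ℂ) (WithLp.toLp 2 v) (WithLp.toLp 2 w)
  rw [EuclideanSpace.inner_eq_star_dotProduct] at h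
  have h2 := pow_le_pow_left₀ (norm_nonneg _) h 2
  rw [mul_pow, EuclideanSpace.norm_sq_eq, EuclideanSpace.norm_sq_eq] at h2
  rwa [dotProduct_comm]

/-- The orthogonal complement of a negative vector is positive definite. -/
theorem Q_pos_of_form_eq_zero {v w : Fin (n + 1) → ℂ} (hv : Q n v < 0) (h : form n v w = 0)
    (hw : w ≠ 0) : 0 < Q n w := by
  by_contra! hle
  rw [form_eq_dotProduct_sub, sub_eq_zero] at h
  have hcs := norm_sq_star_dotProduct_le v w
  rw [h, norm_mul, norm_star, mul_pow] at hcs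
  rw [Q_eq_sum_sub] at hv hle
  have hv0 : 0 ≤ ∑ i, ‖v i‖ ^ 2 := Finset.sum_nonneg fun i _ => sq_nonneg ‖v i‖
  rcases (sq_nonneg ‖w 0 - w (Fin.last n)‖).eq_or_lt with h0 | h0
  · exact hw (eq_zero_of_sum_norm_sq_le (by linarith))
  · nlinarith

/-- The Cauchy–Schwarz inequality is reversed for a negative vector `v`. -/
theorem Q_mul_Q_le_norm_sq_form {v z : Fin (n + 1) → ℂ} (hv : Q n v < 0) :
    Q n v * Q n z ≤ ‖form n v z‖ ^ 2 := by
  set c : ℂ := -(form n v z / Q n v) with hc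
  have hv0 : (Q n v : ℂ) ≠ 0 := by exact_mod_cast hv.ne
  have horth : form n v (z + c • v) = 0 := by
    rw [form_add_right, form_smul_right, form_self, hc]
    field_simp
    ring
  have hpos : 0 ≤ Q n (z + c • v) := by
    rcases eq_or_ne (z + c • v) 0 with h | h
    · simp [h, Q, form]
    · exact (Q_pos_of_form_eq_zero hv horth h).le
  have hQ : Q n (z + c • v) = Q n z - ‖form n v z‖ ^ 2 / Q n v := by
    have : form n (z + c • v) (z + c • v) = ((Q n z - ‖form n v z‖ ^ 2 / Q n v : ℝ) : ℂ) := by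
      rw [form_add_left, form_smul_left, horth, mul_zero, add_zero, form_add_right,
        form_smul_right, form_self, hc, ← star_form v z]
      push_cast
      rw [← Complex.mul_conj', starRingEnd_apply]
      ring
    rw [Q, this, Complex.ofReal_re]
  rw [hQ] at hpos
  have := mul_nonpos_of_nonpos_of_nonneg hv.le hpos
  rw [mul_sub, mul_div_cancel₀ _ hv.ne] at this
  linarith

/-- Orthogonal isotropic vectors are proportional. -/
theorem exists_smul_eq_of_isotropic {p q : Fin (n + 1) → ℂ} (hp : Q n p = 0) (hq : Q n q = 0)
    (hp0 : p ≠ 0) (h : form n p q = 0) : ∃ a : ℂ, a • p = q := by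
  set a : ℂ := p 0 - p (Fin.last n) with ha
  set b : ℂ := q 0 - q (Fin.last n) with hb
  have hQ : Q n (a • q + -b • p) = 0 := by
    rw [Q_add, Q_smul, Q_smul, form_smul_left, form_smul_right, ← star_form p q, h, hp, hq]
    simp
  have ha0 : a ≠ 0 := by
    rintro h0
    rw [Q_eq_sum_sub, ← ha, h0] at hp
    exact hp0 (eq_zero_of_sum_norm_sq_le (by simpa using hp.le))
  rw [Q_eq_sum_sub] at hQ
  have hz : (a • q + -b • p) 0 - (a • q + -b • p) (Fin.last n) = 0 := by
    simp only [Pi.add_apply, Pi.smul_apply, smul_eq_mul]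
    linear_combination a * hb.symm - b * ha.symm
  rw [hz] at hQ
  have h0 := eq_zero_of_sum_norm_sq_le (z := a • q + -b • p) (by simpa using hQ.le)
  refine ⟨b / a, ?_⟩
  rw [neg_smul, ← sub_eq_add_neg, sub_eq_zero] at h0
  rw [div_eq_inv_mul, mul_smul, ← h0, smul_smul, inv_mul_cancel₀ ha0, one_smul]

/-- The horoballs `{|⟨p, z⟩|² < -r ⟨z, z⟩}` and `{|⟨q, z⟩|² < -r ⟨z, z⟩}` centred at the isotropic
lines of `p` and `q` are disjoint when `2 r ≤ |⟨p, q⟩|`. -/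
theorem norm_Q_mul_norm_form_le {p q z : Fin (n + 1) → ℂ} (hp : Q n p = 0) (hq : Q n q = 0)
    (hz : Q n z < 0) (hpz : form n p z ≠ 0) (hqz : form n q z ≠ 0) :
    -Q n z * ‖form n p q‖ ≤ 2 * (‖form n p z‖ * ‖form n q z‖) := by
  rcases eq_or_ne (form n p q) 0 with hc | hc
  · rw [hc]
    simp only [norm_zero, mul_zero]
    positivity
  -- the negative vector `v = p + s q` for which both terms of `⟨z, v⟩` have the same size
  set r : ℝ := ‖form n z p‖ / ‖form n z q‖ with hr
  set s : ℂ := -(r * (star (form n p q) / ‖form n p q‖)) with hs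
  have hc' : 0 < ‖form n p q‖ := norm_pos_iff.2 hc
  have hP : 0 < ‖form n z p‖ := by rw [norm_form_comm]; exact norm_pos_iff.2 hpz
  have hR : 0 < ‖form n z q‖ := by rw [norm_form_comm]; exact norm_pos_iff.2 hqz
  have hr0 : 0 < r := by positivity
  have hsn : ‖s‖ = r := by
    rw [hs, norm_neg, norm_mul, norm_div, norm_star, Complex.norm_real, Complex.norm_real,
      norm_norm, div_self hc'.ne', mul_one, Real.norm_of_nonneg hr0.le]
  have hsc : s * form n p q = ((-(r * ‖form n p q‖) : ℝ) : ℂ) := by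
    have h1 : (‖form n p q‖ : ℂ) ≠ 0 := by exact_mod_cast hc'.ne'
    have h2 : star (form n p q) * form n p q = (‖form n p q‖ : ℂ) ^ 2 := Complex.conj_mul' _
    rw [hs]
    push_cast
    field_simp
    linear_combination (-(r : ℂ)) * h2
  have hQv : Q n (p + s • q) = -(2 * r * ‖form n p q‖) := by
    rw [Q_add, Q_smul, hp, hq, form_smul_right, hsc, Complex.ofReal_re]
    ring
  have hfz : ‖form n z (p + s • q)‖ ≤ 2 * ‖form n z p‖ := by
    rw [form_add_right, form_smul_right]
    refine (norm_add_le _ _).trans ?_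
    rw [norm_mul, hsn, hr, div_mul_cancel₀ _ hR.ne']
    linarith
  have h1 := (Q_mul_Q_le_norm_sq_form (z := p + s • q) hz).trans
    (pow_le_pow_left₀ (norm_nonneg _) hfz 2)
  rw [hQv, hr] at h1
  rw [norm_form_comm p z, norm_form_comm q z]
  have h2 : Q n z * -(2 * (‖form n z p‖ / ‖form n z q‖) * ‖form n p q‖) =
      (-Q n z * ‖form n p q‖) * (2 * ‖form n z p‖ / ‖form n z q‖) := by ring
  have h3 : (2 * ‖form n z p‖) ^ 2 =
      (2 * (‖form n z p‖ * ‖form n z q‖)) * (2 * ‖form n z p‖ / ‖form n z q‖) := by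
    field_simp
  rw [h2, h3] at h1
  exact le_of_mul_le_mul_right h1 (by positivity)

end Form

/-! ### Points of projective space and lengths of isometries -/

section Action

variable {n : ℕ}

theorem exists_rep_mk_eq_smul {v : Fin (n + 1) → ℂ} (hv : v ≠ 0) :
    ∃ c : ℂ, c ≠ 0 ∧ (Projectivization.mk ℂ v hv : Proj n).rep = c • v := by
  have h := Projectivization.mk_rep (Projectivization.mk ℂ v hv)
  rw [Projectivization.mk_eq_mk_iff'] at h
  obtain ⟨c, hc⟩ := h
  refine ⟨c, ?_, hc.symm⟩
  rintro rfl
  rw [zero_smul] at hc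
  exact Projectivization.rep_nonzero _ hc.symm

theorem mk_mem_ball {v : Fin (n + 1) → ℂ} (hv : v ≠ 0) :
    (Projectivization.mk ℂ v hv : Proj n) ∈ ball n ↔ Q n v < 0 := by
  obtain ⟨c, hc, h⟩ := exists_rep_mk_eq_smul hv
  have : 0 < ‖c‖ ^ 2 := by positivity
  rw [ball, Set.mem_ofPred_eq, h, Q_smul, mul_neg_iff]
  simp [this, this.le]

theorem mk_mem_boundary {v : Fin (n + 1) → ℂ} (hv : v ≠ 0) :
    (Projectivization.mk ℂ v hv : Proj n) ∈ boundary n ↔ Q n v = 0 := by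
  obtain ⟨c, hc, h⟩ := exists_rep_mk_eq_smul hv
  rw [boundary, Set.mem_ofPred_eq, h, Q_smul, mul_eq_zero]
  simp [hc]

theorem bergmanDist_mk {v w : Fin (n + 1) → ℂ} (hv : v ≠ 0) (hw : w ≠ 0) :
    bergmanDist (Projectivization.mk ℂ v hv : Proj n) (Projectivization.mk ℂ w hw) =
      2 * Real.arcosh (‖form n v w‖ / √(Q n v * Q n w)) := by
  obtain ⟨c, hc, hcv⟩ := exists_rep_mk_eq_smul hv
  obtain ⟨d, hd, hdw⟩ := exists_rep_mk_eq_smul hw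
  have h1 : ‖c‖ ^ 2 * Q n v * (‖d‖ ^ 2 * Q n w) = (‖c‖ * ‖d‖) ^ 2 * (Q n v * Q n w) := by ring
  have h2 : 0 < ‖c‖ * ‖d‖ := by positivity
  rw [bergmanDist, hcv, hdw, form_smul_left, form_smul_right, Q_smul, Q_smul, h1,
    Real.sqrt_mul (sq_nonneg _), Real.sqrt_sq h2.le, norm_mul, norm_mul, norm_star, ← mul_assoc,
    mul_div_mul_left _ _ h2.ne']

theorem mat_mulVec_ne_zero (A : U n) {v : Fin (n + 1) → ℂ} (hv : v ≠ 0) : mat A *ᵥ v ≠ 0 := by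
  intro h
  have h1 : mat A⁻¹ * mat A = 1 := by simpa using mat_mul_inv A⁻¹
  apply hv
  rw [← one_mulVec v, ← h1, ← mulVec_mulVec, h, mulVec_zero]

theorem mk_smul_mk (A : U n) {v : Fin (n + 1) → ℂ} (hv : v ≠ 0) :
    (QuotientGroup.mk A : PU n) • (Projectivization.mk ℂ v hv : Proj n) =
      Projectivization.mk ℂ (mat A *ᵥ v) (mat_mulVec_ne_zero A hv) := by
  rw [PU_mk_smul, U_smul_mk]

theorem form_mulVec (A : U n) (v w : Fin (n + 1) → ℂ) :
    form n (mat A *ᵥ v) (mat A *ᵥ w) = form n v w := by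
  have h : (mat A)ᴴ * J n * mat A = J n := A.2
  rw [form, form, star_mulVec, ← dotProduct_mulVec, mulVec_mulVec, mulVec_mulVec,
    h]

theorem Q_mulVec (A : U n) (v : Fin (n + 1) → ℂ) : Q n (mat A *ᵥ v) = Q n v := by
  rw [Q, form_mulVec, Q]

theorem smul_mem_ball (γ : PU n) {p : Proj n} (hp : p ∈ ball n) : γ • p ∈ ball n := by
  induction γ using QuotientGroup.induction_on with
  | H A =>
    induction p using Projectivization.ind with
    | h v hv =>
      rw [mk_smul_mk, mk_mem_ball, Q_mulVec]
      exact (mk_mem_ball hv).1 hp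

theorem bergmanDist_nonneg {p q : Proj n} (hp : p ∈ ball n) (hq : q ∈ ball n) :
    0 ≤ bergmanDist p q := by
  have h : 0 < Q n p.rep * Q n q.rep := mul_pos_of_neg_of_neg hp hq
  refine mul_nonneg zero_le_two (Real.arcosh_nonneg ?_)
  rw [one_le_div (Real.sqrt_pos.2 h)]
  exact Real.sqrt_le_iff.2 ⟨norm_nonneg _, Q_mul_Q_le_norm_sq_form hp⟩

theorem length_nonneg (γ : PU n) : 0 ≤ length γ := by
  refine Real.sInf_nonneg ?_
  rintro _ ⟨z, hz, rfl⟩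
  exact bergmanDist_nonneg hz (smul_mem_ball γ hz)

theorem length_le_bergmanDist (γ : PU n) {z : Proj n} (hz : z ∈ ball n) :
    length γ ≤ bergmanDist z (γ • z) := by
  refine csInf_le ⟨0, ?_⟩ ⟨z, hz, rfl⟩
  rintro _ ⟨w, hw, rfl⟩
  exact bergmanDist_nonneg hw (smul_mem_ball γ hw)

theorem systole_le_length {Γ : Subgroup (PU n)} {γ : PU n} (hγ : γ ∈ Γ) (h : IsHyperbolic γ) :
    systole Γ ≤ length γ := by
  refine csInf_le ⟨0, ?_⟩ ⟨γ, hγ, h, rfl⟩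
  rintro _ ⟨δ, -, -, rfl⟩
  exact length_nonneg δ

end Action

/-! ### Hyperbolic isometries from eigenvectors -/

section Eigen

variable {n : ℕ} {A : U n} {e f : Fin (n + 1) → ℂ} {l : ℝ}

/-- Two isotropic vectors that are not orthogonal span a negative vector. -/
theorem Q_add_smul_of_isotropic (he : Q n e = 0) (hf : Q n f = 0) (hef : form n e f ≠ 0) :
    Q n (e + (-(form n e f)⁻¹) • f) = -2 := by
  rw [Q_add, Q_smul, he, hf, form_smul_right, neg_mul, inv_mul_cancel₀ hef]
  norm_num

theorem Q_pos_of_form_eq_zero_of_isotropic {v : Fin (n + 1) → ℂ} (he : Q n e = 0) (hf : Q n f = 0)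
    (hef : form n e f ≠ 0) (hv : v ≠ 0) (hev : form n e v = 0) (hfv : form n f v = 0) :
    0 < Q n v := by
  refine Q_pos_of_form_eq_zero (v := e + (-(form n e f)⁻¹) • f) ?_ ?_ hv
  · rw [Q_add_smul_of_isotropic he hf hef]
    norm_num
  · rw [form_add_left, form_smul_left, hev, hfv, mul_zero, add_zero]

theorem ne_zero_of_form_ne_zero (hef : form n e f ≠ 0) : e ≠ 0 ∧ f ≠ 0 :=
  ⟨by rintro rfl; simp [form] at hef, by rintro rfl; simp [form] at hef⟩

/-- An isometry acting by `l > 1` and `l⁻¹` on two isotropic lines, and trivially on their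
orthogonal complement, fixes no further point of the closed ball. -/
theorem isHyperbolic_of_eigenvectors (he : Q n e = 0) (hf : Q n f = 0) (hef : form n e f ≠ 0)
    (hl : 1 < l) (hAe : mat A *ᵥ e = (l : ℂ) • e) (hAf : mat A *ᵥ f = (l : ℂ)⁻¹ • f)
    (hA : ∀ w, form n e w = 0 → form n f w = 0 → mat A *ᵥ w = w) :
    IsHyperbolic (QuotientGroup.mk A : PU n) := by
  obtain ⟨he0, hf0⟩ := ne_zero_of_form_ne_zero hef
  have hfe : form n f e ≠ 0 := by
    rw [← norm_ne_zero_iff, norm_form_comm, norm_ne_zero_iff]; exact hef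
  have hee : form n e e = 0 := by rw [form_self, he, Complex.ofReal_zero]
  have hff : form n f f = 0 := by rw [form_self, hf, Complex.ofReal_zero]
  have hl0 : (l : ℂ) ≠ 0 := by exact_mod_cast (zero_lt_one.trans hl).ne'
  have hl1 : (l : ℂ) ≠ 1 := by exact_mod_cast hl.ne'
  have hll : (l : ℂ) ≠ (l : ℂ)⁻¹ := by
    have : l⁻¹ < l := (inv_lt_one_of_one_lt₀ hl).trans hl
    exact_mod_cast this.ne'
  have hli : (l : ℂ)⁻¹ ≠ 1 := by simpa using hl1
  refine ⟨Projectivization.mk ℂ e he0, (mk_mem_boundary he0).2 he, Projectivization.mk ℂ f hf0,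
    (mk_mem_boundary hf0).2 hf, ?_, ?_⟩
  · intro h
    rw [Projectivization.mk_eq_mk_iff'] at h
    obtain ⟨a, ha⟩ := h
    apply hef
    rw [← ha, form_smul_left, hff, mul_zero]
  · ext r
    simp only [Set.mem_sep_iff, Set.mem_insert_iff, Set.mem_singleton_iff]
    constructor
    · induction r using Projectivization.ind with
      | h v hv =>
        rintro ⟨hr, hfix⟩
        rw [mk_smul_mk, Projectivization.mk_eq_mk_iff'] at hfix
        obtain ⟨μ, hμ⟩ := hfix
        have hQ : Q n v ≤ 0 := hr.elim (fun h => ((mk_mem_ball hv).1 h).le)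
          (fun h => ((mk_mem_boundary hv).1 h).le)
        set α : ℂ := form n f v / form n f e with hα
        set β : ℂ := form n e v / form n e f with hβ
        set w : Fin (n + 1) → ℂ := v - α • e - β • f with hw
        have hvw : v = w + α • e + β • f := by rw [hw]; abel
        have hew : form n e w = 0 := by
          have := congrArg (form n e) hvw
          rw [form_add_right, form_add_right, form_smul_right, form_smul_right, hee, hβ,
            div_mul_cancel₀ _ hef] at this
          linear_combination -this
        have hfw : form n f w = 0 := by
          have := congrArg (form n f) hvw
          rw [form_add_right, form_add_right, form_smul_right, form_smul_right, hff, hα,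
            div_mul_cancel₀ _ hfe] at this
          linear_combination -this
        have hAv : mat A *ᵥ v = w + (α * l) • e + (β * (l : ℂ)⁻¹) • f := by
          rw [hvw, mulVec_add, mulVec_add, mulVec_smul, mulVec_smul, hAe, hAf, hA w hew hfw,
            smul_smul, smul_smul]
        rw [← hμ] at hAv
        have h1 : α * (μ - l) = 0 := by
          have h2 := congrArg (form n f) hAv
          rw [form_add_right, form_add_right, form_smul_right, form_smul_right, form_smul_right,
            hff, hfw, show form n f v = α * form n f e from (div_mul_cancel₀ _ hfe).symm] at h2
          apply mul_right_cancel₀ hfe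
          linear_combination h2
        have h2 : β * (μ - (l : ℂ)⁻¹) = 0 := by
          have h2 := congrArg (form n e) hAv
          rw [form_add_right, form_add_right, form_smul_right, form_smul_right, form_smul_right,
            hee, hew, show form n e v = β * form n e f from (div_mul_cancel₀ _ hef).symm] at h2
          apply mul_right_cancel₀ hef
          linear_combination h2
        have h3 : (μ - 1) • w = 0 := by
          rw [hvw] at hAv
          ext i
          have h4 := congrFun hAv i
          simp only [Pi.add_apply, Pi.smul_apply, smul_eq_mul, Pi.zero_apply] at h4 ⊢
          linear_combination h4 - e i * h1 - f i * h2
        rw [Projectivization.mk_eq_mk_iff', Projectivization.mk_eq_mk_iff']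
        rcases eq_or_ne α 0 with hα0 | hα0
        · rcases eq_or_ne β 0 with hβ0 | hβ0
          · rw [hα0, hβ0, zero_smul, zero_smul, add_zero, add_zero] at hvw
            rw [← hvw] at hew hfw
            exact absurd (Q_pos_of_form_eq_zero_of_isotropic he hf hef hv hew hfw) hQ.not_gt
          · have hm : μ = (l : ℂ)⁻¹ := sub_eq_zero.1 ((mul_eq_zero.1 h2).resolve_left hβ0)
            have hw0 : w = 0 := (smul_eq_zero.1 h3).resolve_left (hm ▸ sub_ne_zero.2 hli)
            right
            exact ⟨β, by rw [hvw, hw0, hα0, zero_smul, zero_add, zero_add]⟩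
        · have hm : μ = l := sub_eq_zero.1 ((mul_eq_zero.1 h1).resolve_left hα0)
          have hw0 : w = 0 := (smul_eq_zero.1 h3).resolve_left (hm ▸ sub_ne_zero.2 hl1)
          have hβ0 : β = 0 := (mul_eq_zero.1 h2).resolve_right (by rw [hm]; exact sub_ne_zero.2 hll)
          left
          exact ⟨α, by rw [hvw, hw0, hβ0, zero_smul, zero_add, add_zero]⟩
    · rintro (rfl | rfl)
      · refine ⟨Or.inr ((mk_mem_boundary he0).2 he), ?_⟩
        rw [mk_smul_mk, Projectivization.mk_eq_mk_iff']
        exact ⟨l, hAe.symm⟩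
      · refine ⟨Or.inr ((mk_mem_boundary hf0).2 hf), ?_⟩
        rw [mk_smul_mk, Projectivization.mk_eq_mk_iff']
        exact ⟨(l : ℂ)⁻¹, hAf.symm⟩

/-- A point on the axis joining the two fixed points is moved by `2 log l`. -/
theorem length_le_of_eigenvectors (he : Q n e = 0) (hf : Q n f = 0) (hef : form n e f ≠ 0)
    (hl : 1 < l) (hAe : mat A *ᵥ e = (l : ℂ) • e) (hAf : mat A *ᵥ f = (l : ℂ)⁻¹ • f) :
    length (QuotientGroup.mk A : PU n) ≤ 2 * Real.log l := by
  set s : ℂ := -(form n e f)⁻¹ with hs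
  have hQ : Q n (e + s • f) = -2 := Q_add_smul_of_isotropic he hf hef
  have hz : e + s • f ≠ 0 := by
    intro h
    rw [h] at hQ
    simp [Q, form] at hQ
  have hee : form n e e = 0 := by rw [form_self, he, Complex.ofReal_zero]
  have hff : form n f f = 0 := by rw [form_self, hf, Complex.ofReal_zero]
  have hsc : s * form n e f = -1 := by rw [hs, neg_mul, inv_mul_cancel₀ hef]
  have hsc' : star s * form n f e = -1 := by
    rw [← star_form e f, ← star_mul', hsc]
    simp
  have hform : form n (e + s • f) (mat A *ᵥ (e + s • f)) = ((-(l + l⁻¹) : ℝ) : ℂ) := by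
    rw [mulVec_add, mulVec_smul, hAe, hAf]
    simp only [form_add_left, form_add_right, form_smul_left, form_smul_right, hee, hff]
    push_cast
    linear_combination (l : ℂ)⁻¹ * hsc + l * hsc'
  have hl0 : 0 < l := zero_lt_one.trans hl
  refine (length_le_bergmanDist _ ((mk_mem_ball hz).2 (by rw [hQ]; norm_num))).trans_eq ?_
  rw [mk_smul_mk, bergmanDist_mk, Q_mulVec, hQ, hform, Complex.norm_real, norm_neg,
    Real.norm_of_nonneg (by positivity), Real.sqrt_mul_self_eq_abs, abs_neg, abs_two,
    ← Real.cosh_log hl0, Real.arcosh_cosh (Real.log_nonneg hl.le)]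

end Eigen

/-! ### Products of two unipotent isometries with different fixed points -/

section Product

variable {n : ℕ} {A : U n} {p q : Fin (n + 1) → ℂ} {a b : ℝ}

/-- The plane spanned by `p` and `q` is invariant under the product of the two unipotent maps
`v ↦ v + i a ⟨p, v⟩ p` and `v ↦ v - i b ⟨q, v⟩ q`, which acts on it with determinant `1` and trace
`2 + a b |⟨p, q⟩|²`. -/
theorem isHyperbolic_and_length_le (hp : Q n p = 0) (hq : Q n q = 0) (hpq : form n p q ≠ 0)
    (ha : 0 < a) (hb : 0 < b)
    (hA : ∀ v, mat A *ᵥ v = v + (-(Complex.I * b * form n q v)) • q +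
      (Complex.I * a * form n p (v + (-(Complex.I * b * form n q v)) • q)) • p) :
    IsHyperbolic (QuotientGroup.mk A : PU n) ∧
      length (QuotientGroup.mk A : PU n) ≤
        2 * Real.arcosh (1 + a * b * ‖form n p q‖ ^ 2 / 2) := by
  have hc0 : 0 < ‖form n p q‖ := norm_pos_iff.2 hpq
  set x : ℝ := a * b * ‖form n p q‖ ^ 2 with hx
  have hx0 : 0 < x := by positivity
  set l : ℝ := Real.exp (Real.arcosh (1 + x / 2)) with hl
  have hl1 : 1 < l := Real.one_lt_exp_iff.2 (Real.arcosh_pos (by linarith))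
  have hlog : Real.log l = Real.arcosh (1 + x / 2) := Real.log_exp _
  have htr : l + l⁻¹ = 2 + x := by
    have h := Real.cosh_arcosh (x := 1 + x / 2) (by linarith)
    rw [Real.cosh_eq, Real.exp_neg, ← hl] at h
    linarith
  clear_value l
  have hl0 : (l : ℂ) ≠ 0 := by exact_mod_cast (zero_lt_one.trans hl1).ne'
  have hl1' : (1 : ℂ) - l ≠ 0 := by
    rw [sub_ne_zero]; exact_mod_cast hl1.ne
  have hl1'' : (1 : ℂ) - (l : ℂ)⁻¹ ≠ 0 := by
    rw [sub_ne_zero]; exact_mod_cast (inv_lt_one_of_one_lt₀ hl1).ne'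
  have htr' : (l : ℂ) + (l : ℂ)⁻¹ = 2 + x := by exact_mod_cast htr
  have hpp : form n p p = 0 := by rw [form_self, hp, Complex.ofReal_zero]
  have hqq : form n q q = 0 := by rw [form_self, hq, Complex.ofReal_zero]
  set c : ℂ := form n p q with hc
  have hqp : form n q p = star c := (star_form p q).symm
  have hcc : c * star c = (‖c‖ : ℂ) ^ 2 := Complex.mul_conj' c
  have hxc : (x : ℂ) = a * b * (c * star c) := by rw [hcc, hx]; push_cast; ring
  -- eigenvectors for a root `m` of the characteristic polynomial `m² - (2 + x) m + 1`
  have heig : ∀ m : ℂ, 1 - m ≠ 0 → m ≠ 0 → m + m⁻¹ = 2 + x →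
      mat A *ᵥ (p + (Complex.I * b * star c / (1 - m)) • q) =
        m • (p + (Complex.I * b * star c / (1 - m)) • q) := by
    intro m hm hm0 hmx
    have hquad : m * m + 1 = (2 + x) * m := by rw [← hmx]; field_simp
    rw [hA]
    simp only [form_add_right, form_smul_right, hpp, hqq, hqp, ← hc]
    ext i
    simp only [Pi.add_apply, Pi.smul_apply, smul_eq_mul]
    field_simp
    rw [hxc] at hquad
    linear_combination (p i) * hquad + a * b * c * star c * p i * m * Complex.I_sq
  have hiso : ∀ m : ℝ, Q n (p + (Complex.I * b * star c / (1 - m)) • q) = 0 := by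
    intro m
    have h : Complex.I * b * star c / (1 - m) * c =
        Complex.I * ((b * ‖c‖ ^ 2 / (1 - m) : ℝ) : ℂ) := by
      push_cast
      linear_combination Complex.I * b / (1 - m) * hcc
    rw [Q_add, Q_smul, hp, hq, form_smul_right, ← hc, h, Complex.re_mul_ofReal]
    simp
  have hli : ((l⁻¹ : ℝ) : ℂ) = (l : ℂ)⁻¹ := Complex.ofReal_inv l
  have hQe := hiso l
  have hQf := hiso l⁻¹
  have hAe := heig l hl1' hl0 htr'
  have hAf := heig (l : ℂ)⁻¹ hl1'' (inv_ne_zero hl0) (by rw [inv_inv, add_comm, htr'])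
  rw [hli] at hQf
  set β : ℂ := Complex.I * b * star c / (1 - l) with hβ
  set β' : ℂ := Complex.I * b * star c / (1 - (l : ℂ)⁻¹) with hβ'
  have hb0 : (b : ℂ) ≠ 0 := by exact_mod_cast hb.ne'
  have hββ : β - β' ≠ 0 := by
    have hll : (l : ℂ) - (l : ℂ)⁻¹ ≠ 0 := by
      have : l⁻¹ < l := (inv_lt_one_of_one_lt₀ hl1).trans hl1
      rw [sub_ne_zero]
      exact_mod_cast this.ne'
    have h : β - β' = Complex.I * b * star c * ((l : ℂ) - (l : ℂ)⁻¹) /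
        ((1 - l) * (1 - (l : ℂ)⁻¹)) := by
      rw [hβ, hβ', div_sub_div _ _ hl1' hl1'']
      ring
    rw [h]
    exact div_ne_zero (mul_ne_zero (mul_ne_zero (mul_ne_zero Complex.I_ne_zero hb0)
      (star_ne_zero.2 hpq)) hll) (mul_ne_zero hl1' hl1'')
  have hef : form n (p + β • q) (p + β' • q) ≠ 0 := by
    -- `⟨e, e⟩ = 0` turns `⟨e, e + (β' - β) q⟩` into `(β' - β) ⟨p, q⟩`
    have h : form n (p + β • q) (p + β • q) = 0 := by rw [form_self, hQe, Complex.ofReal_zero]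
    have h2 : form n (p + β • q) (p + β' • q) = -((β - β') * c) := by
      simp only [form_add_left, form_add_right, form_smul_left, form_smul_right, hqq, ← hc] at h ⊢
      linear_combination h
    rw [h2]
    exact neg_ne_zero.2 (mul_ne_zero hββ hpq)
  refine ⟨isHyperbolic_of_eigenvectors hQe hQf hef hl1 hAe hAf ?_,
    hlog ▸ length_le_of_eigenvectors hQe hQf hef hl1 hAe hAf⟩
  intro w h1 h2
  rw [form_add_left, form_smul_left] at h1 h2
  have hqw : form n q w = 0 := by
    have h : star (β - β') * form n q w = 0 := by
      rw [star_sub]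
      linear_combination h1 - h2
    exact (mul_eq_zero.1 h).resolve_left (star_ne_zero.2 hββ)
  have hpw : form n p w = 0 := by simpa [hqw] using h1
  rw [hA, hqw, mul_zero, neg_zero, zero_smul, add_zero, hpw, mul_zero, zero_smul, add_zero]

end Product

/-! ### Vertical translations and heights -/

section Cusp

variable {n : ℕ}

theorem form_single_zero (z : Fin (n + 1) → ℂ) : form n (Pi.single 0 1) z = z (Fin.last n) := by
  have h : star (Pi.single 0 1 : Fin (n + 1) → ℂ) = Pi.single 0 1 := by
    rw [← Pi.single_star, star_one]
  rw [form, h, single_one_dotProduct, J, permMatrix_mulVec]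
  simp

theorem Q_single_zero (hn : 1 ≤ n) : Q n (Pi.single 0 1) = 0 := by
  have h : Fin.last n ≠ 0 := by
    intro h
    have := congrArg Fin.val h
    simp at this
    omega
  rw [Q, form_single_zero, Pi.single_eq_of_ne h, Complex.zero_re]

theorem form_inv_mulVec (A : U n) (v w : Fin (n + 1) → ℂ) :
    form n (mat A⁻¹ *ᵥ v) w = form n v (mat A *ᵥ w) := by
  rw [← form_mulVec A (mat A⁻¹ *ᵥ v) w, mulVec_mulVec, mat_mul_inv, one_mulVec]

theorem mat_mul_mulVec (A B : U n) (v : Fin (n + 1) → ℂ) :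
    mat (A * B) *ᵥ v = mat A *ᵥ (mat B *ᵥ v) := (mulVec_mulVec v (mat A) (mat B)).symm

theorem mat_mulVec_inv_mulVec (A : U n) (v : Fin (n + 1) → ℂ) :
    mat A *ᵥ (mat A⁻¹ *ᵥ v) = v := by
  rw [mulVec_mulVec, mat_mul_inv, one_mulVec]

theorem heightCoord_mk {v : Fin (n + 1) → ℂ} (hv : v ≠ 0) :
    heightCoord (Projectivization.mk ℂ v hv : Proj n) =
      -Q n v / ‖form n (Pi.single 0 1) v‖ ^ 2 := by
  obtain ⟨c, hc, h⟩ := exists_rep_mk_eq_smul hv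
  have hc2 : ‖c‖ ^ 2 ≠ 0 := by positivity
  rw [heightCoord, h, Q_smul, form_single_zero, Pi.smul_apply, smul_eq_mul, norm_mul, mul_pow,
    ← mul_neg, mul_div_mul_left _ _ hc2]

theorem transvection_mulVec_eq_add {T : U n} {s : ℂ}
    (hT : mat T = Matrix.transvection 0 (Fin.last n) s) (v : Fin (n + 1) → ℂ) :
    mat T *ᵥ v = v + (s * form n (Pi.single 0 1) v) • (Pi.single 0 1 : Fin (n + 1) → ℂ) := by
  rw [hT, transvection, add_mulVec, one_mulVec, form_single_zero]
  congr 1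
  ext i
  rw [single_mulVec]
  simp [Pi.single_apply, Function.update_apply]

theorem transvection_inv_mulVec_eq_add (hn : 1 ≤ n) {T : U n} {s : ℂ}
    (hT : mat T = Matrix.transvection 0 (Fin.last n) s) (v : Fin (n + 1) → ℂ) :
    mat T⁻¹ *ᵥ v =
      v + (-s * form n (Pi.single 0 1) v) • (Pi.single 0 1 : Fin (n + 1) → ℂ) := by
  set e : Fin (n + 1) → ℂ := Pi.single 0 1 with he
  have hee : form n e e = 0 := by rw [form_self, he, Q_single_zero hn, Complex.ofReal_zero]
  have h : mat T *ᵥ (v + (-s * form n e v) • e) = v := by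
    rw [transvection_mulVec_eq_add hT, ← he, form_add_right, form_smul_right, hee, add_assoc,
      ← add_smul, mul_zero, add_zero, ← add_mul, neg_add_cancel, zero_mul, zero_smul, add_zero]
  have h1 : mat T⁻¹ *ᵥ (mat T *ᵥ (v + (-s * form n e v) • e)) = v + (-s * form n e v) • e := by
    simpa using mat_mulVec_inv_mulVec T⁻¹ (v + (-s * form n e v) • e)
  rwa [h] at h1

/-- Conjugating a transvection based at `e` by `B` gives the one based at `B e`. -/
theorem conj_transvection_mulVec {B T : U n} {s : ℂ} {e : Fin (n + 1) → ℂ}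
    (hT : ∀ v, mat T *ᵥ v = v + (s * form n e v) • e) (v : Fin (n + 1) → ℂ) :
    mat (B * T * B⁻¹) *ᵥ v = v + (s * form n (mat B *ᵥ e) v) • (mat B *ᵥ e) := by
  have h : form n e (mat B⁻¹ *ᵥ v) = form n (mat B *ᵥ e) v := by
    rw [← form_inv_mulVec, inv_inv]
  rw [mat_mul_mulVec, mat_mul_mulVec, hT, mulVec_add, mulVec_smul, h, mat_mulVec_inv_mulVec]

/-- For vertical translations at two different parabolic fixed points (possibly `Γ`-equivalent
ones), the product of one with the inverse of the other is hyperbolic with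
`2 cosh (ℓ / 2) = 2 + X`, where `X = t₁ t₂ |⟨p, q⟩|² / 4` for the isotropic vectors `p`, `q` that
correspond to `q_∞` in the two charts. On the other hand, the product of the heights of one point of the ball with respect to
`p` and `q` is at most `4 / |⟨p, q⟩|²`. -/
theorem exp_systole_mul_heightCoord_le (hn : 1 ≤ n) {Γ : Subgroup (PU n)} {g h γ : PU n}
    (hγ : γ ∈ Γ) (hne : γ • (g⁻¹ • qInf n) ≠ h⁻¹ • qInf n) {t₁ t₂ : ℝ} (ht₁ : 0 < t₁)
    (ht₂ : 0 < t₂) (hv₁ : ∃ τ ∈ conj g Γ, IsVerticalTranslation t₁ τ)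
    (hv₂ : ∃ τ ∈ conj h Γ, IsVerticalTranslation t₂ τ) {x y : Proj n} (hx : x ∈ ball n)
    (hux : 0 < heightCoord x) (huy : 0 < heightCoord y) (hxy : γ • (g⁻¹ • x) = h⁻¹ • y) :
    (Real.exp (systole Γ / 2) - 2) * (heightCoord x * heightCoord y) ≤ t₁ * t₂ := by
  obtain ⟨τ₁, hτ₁, T₁, rfl, hT₁⟩ := hv₁
  obtain ⟨τ₂, hτ₂, T₂, rfl, hT₂⟩ := hv₂
  obtain ⟨δ₁, hδ₁, hδτ₁⟩ := hτ₁
  obtain ⟨δ₂, hδ₂, hδτ₂⟩ := hτ₂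
  obtain ⟨G, rfl⟩ := QuotientGroup.mk_surjective g
  obtain ⟨H, rfl⟩ := QuotientGroup.mk_surjective h
  obtain ⟨C, rfl⟩ := QuotientGroup.mk_surjective γ
  have hy : y = ((H * (C * G⁻¹) : U n) : PU n) • x := by
    rw [QuotientGroup.mk_mul, QuotientGroup.mk_mul, QuotientGroup.mk_inv, mul_smul, mul_smul, hxy,
      smul_inv_smul]
  subst hy
  induction x using Projectivization.ind with
  | h v hv =>
  rw [mk_smul_mk] at huy ⊢
  rw [mk_mem_ball] at hx
  rw [heightCoord_mk] at hux huy ⊢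
  rw [heightCoord_mk]
  set e : Fin (n + 1) → ℂ := Pi.single 0 1 with he
  have he0 : e ≠ 0 := by simp [he]
  -- the isotropic vectors representing the two cusps, and the common point of the two horoballs
  set p : Fin (n + 1) → ℂ := mat H⁻¹ *ᵥ e with hp
  set q : Fin (n + 1) → ℂ := mat (C * G⁻¹) *ᵥ e with hq
  set w : Fin (n + 1) → ℂ := mat (C * G⁻¹) *ᵥ v with hw
  have hQp : Q n p = 0 := by rw [hp, Q_mulVec, he, Q_single_zero hn]
  have hQq : Q n q = 0 := by rw [hq, Q_mulVec, he, Q_single_zero hn]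
  have hQw : Q n w = Q n v := Q_mulVec _ _
  have hpw : form n e (mat (H * (C * G⁻¹)) *ᵥ v) = form n p w := by
    rw [mat_mul_mulVec, hp, form_inv_mulVec]
  have hqw : form n e v = form n q w := by rw [hq, hw, form_mulVec]
  rw [← hQw] at hx
  rw [hqw, ← hQw] at hux
  rw [Q_mulVec, hpw, ← hQw] at huy
  rw [Q_mulVec, hpw, hqw, ← hQw]
  have hpq : form n p q ≠ 0 := by
    intro h0
    have hp0 : p ≠ 0 := mat_mulVec_ne_zero _ he0
    obtain ⟨a, ha⟩ := exists_smul_eq_of_isotropic hQp hQq hp0 h0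
    apply hne
    rw [← mul_smul, ← QuotientGroup.mk_inv, ← QuotientGroup.mk_inv, ← QuotientGroup.mk_mul, qInf,
      mk_smul_mk, mk_smul_mk, Projectivization.mk_eq_mk_iff']
    exact ⟨a, ha⟩
  have hpw0 : form n p w ≠ 0 := by
    intro h0
    simp [h0] at huy
  have hqw0 : form n q w ≠ 0 := by
    intro h0
    simp [h0] at hux
  have hT₁' := transvection_inv_mulVec_eq_add hn hT₁
  have hT₂' := transvection_mulVec_eq_add hT₂
  have hA := isHyperbolic_and_length_le (A := H⁻¹ * T₂ * H⁻¹⁻¹ * (C * G⁻¹ * T₁⁻¹ * (C * G⁻¹)⁻¹))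
    hQp hQq hpq (half_pos ht₂) (half_pos ht₁) (by
      intro z
      rw [mat_mul_mulVec, conj_transvection_mulVec hT₁', conj_transvection_mulVec hT₂', ← he, ← hp,
        ← hq]
      have h1 : -(Complex.I * t₁ / 2) * form n q z =
          -(Complex.I * ((t₁ / 2 : ℝ) : ℂ) * form n q z) := by push_cast; ring
      have h2 : Complex.I * t₂ / 2 = Complex.I * ((t₂ / 2 : ℝ) : ℂ) := by push_cast; ring
      rw [h1, h2])
  have hmem : ((H⁻¹ * T₂ * H⁻¹⁻¹ * (C * G⁻¹ * T₁⁻¹ * (C * G⁻¹)⁻¹) : U n) : PU n) ∈ Γ := by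
    have h1 : ((H⁻¹ * T₂ * H⁻¹⁻¹ * (C * G⁻¹ * T₁⁻¹ * (C * G⁻¹)⁻¹) : U n) : PU n) =
        δ₂ * ((C : PU n) * δ₁⁻¹ * (C : PU n)⁻¹) := by
      simp only [QuotientGroup.mk_mul, QuotientGroup.mk_inv, ← hδτ₁, ← hδτ₂,
        MulEquiv.coe_toMonoidHom, MulAut.conj_apply]
      group
    rw [h1]
    exact Γ.mul_mem hδ₂ (Γ.mul_mem (Γ.mul_mem hγ (Γ.inv_mem hδ₁)) (Γ.inv_mem hγ))
  have hsys := (systole_le_length hmem hA.1).trans hA.2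
  set X : ℝ := t₂ / 2 * (t₁ / 2) * ‖form n p q‖ ^ 2 with hX
  have hX0 : 0 ≤ X := by positivity
  have hexp : Real.exp (systole Γ / 2) - 2 ≤ X := by
    -- `e^y ≤ 2 cosh y` for `y = arcosh (1 + X / 2)`
    have h1 : Real.exp (systole Γ / 2) ≤ Real.exp (Real.arcosh (1 + X / 2)) :=
      Real.exp_le_exp.2 (by linarith)
    have h2 := Real.cosh_arcosh (x := 1 + X / 2) (by linarith)
    rw [Real.cosh_eq] at h2
    have h3 := Real.exp_pos (-Real.arcosh (1 + X / 2))
    linarith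
  refine (mul_le_mul_of_nonneg_right hexp (mul_pos hux huy).le).trans ?_
  have hkey := norm_Q_mul_norm_form_le hQp hQq hx hpw0 hqw0
  have hN : 0 < ‖form n p w‖ * ‖form n q w‖ := by positivity
  have hkey2 : (-Q n w * ‖form n p q‖) ^ 2 ≤ (2 * (‖form n p w‖ * ‖form n q w‖)) ^ 2 :=
    pow_le_pow_left₀ (mul_nonneg (by linarith) (norm_nonneg _)) hkey 2
  have heq : X * (-Q n w / ‖form n q w‖ ^ 2 * (-Q n w / ‖form n p w‖ ^ 2)) =
      t₁ * t₂ * ((-Q n w * ‖form n p q‖) ^ 2 / (2 * (‖form n p w‖ * ‖form n q w‖)) ^ 2) := by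
    rw [hX]
    field_simp
  rw [heq]
  exact mul_le_of_le_one_right (by positivity) (div_le_one_of_le₀ hkey2 (by positivity))

/-! ### The uniform depth -/

/-- A cusp whose shortest vertical translation has positive length `t` does have vertical
translations: the infimum of the empty set would be `0`. -/
theorem nonempty_of_shortestVertical_pos {Γ : Subgroup (PU n)} (h : 0 < shortestVertical Γ) :
    {t : ℝ | 0 < t ∧ ∃ γ ∈ Γ, IsVerticalTranslation t γ}.Nonempty := by
  rw [Set.nonempty_iff_ne_empty]
  intro h0
  rw [shortestVertical, h0, Real.sInf_empty] at h
  exact h.false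

/-- If `D² ≤ e^(sys / 2) - 2`, the horoballs of height `t / D` at two distinct parabolic fixed
points are disjoint. Here `t` is an infimum that need not be attained, so that the inequality between
heights and vertical translations is passed to the infimum in each factor. -/
theorem not_smul_eq_of_mem_horoball (hn : 1 ≤ n) {Γ : Subgroup (PU n)} {g h γ : PU n}
    (hγ : γ ∈ Γ) (hne : γ • (g⁻¹ • qInf n) ≠ h⁻¹ • qInf n)
    (hg : 0 < shortestVertical (conj g Γ)) (hh : 0 < shortestVertical (conj h Γ))
    {D : ℝ} (hD : 0 < D) (hDs : D ^ 2 ≤ Real.exp (systole Γ / 2) - 2) {x y : Proj n}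
    (hx : x ∈ horoball n (shortestVertical (conj g Γ) / D))
    (hy : y ∈ horoball n (shortestVertical (conj h Γ) / D)) : γ • (g⁻¹ • x) ≠ h⁻¹ • y := by
  intro hxy
  obtain ⟨hxb, hux⟩ := hx
  obtain ⟨-, huy⟩ := hy
  set u₁ := heightCoord x
  set u₂ := heightCoord y
  set t₁ := shortestVertical (conj g Γ)
  set t₂ := shortestVertical (conj h Γ)
  have hu₁ : 0 < u₁ := (div_pos hg hD).trans hux
  have hu₂ : 0 < u₂ := (div_pos hh hD).trans huy
  rw [div_lt_iff₀ hD] at hux huy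
  set K := D ^ 2 * (u₁ * u₂) with hK
  have hall : ∀ s₁ ∈ {t : ℝ | 0 < t ∧ ∃ τ ∈ conj g Γ, IsVerticalTranslation t τ},
      ∀ s₂ ∈ {t : ℝ | 0 < t ∧ ∃ τ ∈ conj h Γ, IsVerticalTranslation t τ}, K ≤ s₁ * s₂ := by
    intro s₁ hs₁ s₂ hs₂
    exact (mul_le_mul_of_nonneg_right hDs (mul_pos hu₁ hu₂).le).trans
      (exp_systole_mul_heightCoord_le hn hγ hne hs₁.1 hs₂.1 hs₁.2 hs₂.2 hxb hu₁ hu₂ hxy)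
  have h1 : ∀ s₂ ∈ {t : ℝ | 0 < t ∧ ∃ τ ∈ conj h Γ, IsVerticalTranslation t τ},
      K ≤ t₁ * s₂ := by
    intro s₂ hs₂
    rw [← div_le_iff₀ hs₂.1]
    refine le_csInf (nonempty_of_shortestVertical_pos hg) fun s₁ hs₁ => ?_
    rw [div_le_iff₀ hs₂.1]
    exact hall s₁ hs₁ s₂ hs₂
  have h2 : K ≤ t₁ * t₂ := by
    rw [← div_le_iff₀' hg]
    refine le_csInf (nonempty_of_shortestVertical_pos hh) fun s₂ hs₂ => ?_
    rw [div_le_iff₀' hg]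
    exact h1 s₂ hs₂
  have h3 : t₁ * t₂ < u₁ * D * (u₂ * D) := mul_lt_mul'' hux huy hg.le hh.le
  nlinarith

theorem shortestVertical_nonneg (Γ : Subgroup (PU n)) : 0 ≤ shortestVertical Γ :=
  Real.sInf_nonneg fun _ ht => ht.1.le

theorem cuspHeight_nonneg (Γ : Subgroup (PU n)) : 0 ≤ cuspHeight Γ :=
  Real.sInf_nonneg fun _ hu => hu.1.le

theorem shortestVertical_pos_and_cuspHeight_pos {Γ : Subgroup (PU n)} (h : 0 < cuspDepth Γ) :
    0 < shortestVertical Γ ∧ 0 < cuspHeight Γ := by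
  have h1 : shortestVertical Γ ≠ 0 := by
    intro h0
    simp [cuspDepth, h0] at h
  have h2 : cuspHeight Γ ≠ 0 := by
    intro h0
    simp [cuspDepth, h0] at h
  exact ⟨(shortestVertical_nonneg Γ).lt_of_ne' h1, (cuspHeight_nonneg Γ).lt_of_ne' h2⟩

/-- All depths up to `√(e^(sys / 2) - 2)` are admissible, for any `Γ` whose cusps have positive
depth. The case `h = g` of `not_smul_eq_of_mem_horoball` gives the injectivity of a single
horoball, the general case the disjointness of the horoballs at different cusps. -/
theorem isAdmissibleDepth_of_sq_le (hn : 1 ≤ n) {Γ : Subgroup (PU n)}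
    (hpos : ∀ g : PU n, IsCuspChart Γ g → 0 < cuspDepth (conj g Γ)) {D : ℝ} (hD : 0 < D)
    (hDs : D ^ 2 ≤ Real.exp (systole Γ / 2) - 2) : IsAdmissibleDepth Γ D := by
  refine ⟨hD, fun g hg => ?_, fun g h hg hh hne => ?_⟩
  -- since the cusp height is positive, `D ≤ t / u` says that the horoball of height `t / D` injects
  · obtain ⟨ht, hu⟩ := shortestVertical_pos_and_cuspHeight_pos (hpos g hg)
    rw [cuspDepth, le_div_iff₀ hu, mul_comm, ← le_div_iff₀ hD]
    refine csInf_le ⟨0, fun _ hs => hs.1.le⟩ ⟨div_pos ht hD, ?_⟩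
    rintro x hx y hy ⟨γ, hγ, rfl⟩
    refine ⟨γ, hγ, ?_, rfl⟩
    by_contra hfix
    obtain ⟨δ, hδ, rfl⟩ := hγ
    simp only [MulEquiv.coe_toMonoidHom, MulAut.conj_apply] at hfix hy
    refine not_smul_eq_of_mem_horoball hn hδ (fun h => hfix ?_) ht ht hD hDs hx hy ?_
    · rw [mul_smul, mul_smul, h, smul_inv_smul]
    · simp only [mul_smul, inv_smul_smul]
  · rintro _ ⟨x, hx, rfl⟩ _ ⟨y, hy, rfl⟩ γ hγ
    exact not_smul_eq_of_mem_horoball hn hγ (hne γ hγ)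
      (shortestVertical_pos_and_cuspHeight_pos (hpos g hg)).1
      (shortestVertical_pos_and_cuspHeight_pos (hpos h hh)).1 hD hDs hx hy

theorem sq_min_rpow_le {r : ℝ} (hr : 0 ≤ r) :
    min (r ^ (1 / 4 : ℝ)) (r ^ (1 / 2 : ℝ)) ^ 2 ≤ r := by
  have h : min (r ^ (1 / 4 : ℝ)) (r ^ (1 / 2 : ℝ)) ^ 2 ≤ (r ^ (1 / 2 : ℝ)) ^ 2 :=
    pow_le_pow_left₀ (le_min (by positivity) (by positivity)) (min_le_right _ _) 2
  rwa [← Real.sqrt_eq_rpow, Real.sq_sqrt hr, Real.sqrt_eq_rpow] at h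

theorem min_rpow_le_of_isUniformDepth (hn : 1 ≤ n) {Γ : Subgroup (PU n)} {d : ℝ}
    (hd : IsUniformDepth Γ d)
    (hs : 2 * n ≤ √2 * Real.exp (systole Γ / 4)) :
    min ((√2 * Real.exp (systole Γ / 4) - 2 * n) ^ (1 / 4 : ℝ))
      ((√2 * Real.exp (systole Γ / 4) - 2 * n) ^ (1 / 2 : ℝ)) ≤ d := by
  set s : ℝ := √2 * Real.exp (systole Γ / 4) with hs'
  have hn' : (1 : ℝ) ≤ n := by exact_mod_cast hn
  have hs2 : s ^ 2 = 2 * Real.exp (systole Γ / 2) := by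
    rw [hs', mul_pow, Real.sq_sqrt zero_le_two, ← Real.exp_nat_mul]
    congr 2
    push_cast
    ring
  have hr : 0 ≤ s - 2 * n := by linarith
  rcases (le_min (Real.rpow_nonneg hr (1 / 4)) (Real.rpow_nonneg hr (1 / 2))).eq_or_lt with h0 | h0
  -- an admissible depth is positive, so the bound `0` is treated apart
  · rw [← h0]
    exact hd.1.1.le
  · refine hd.2 (isAdmissibleDepth_of_sq_le hn (fun g hg => hd.1.1.trans_le (hd.1.2.1 g hg)) h0 ?_)
    refine (sq_min_rpow_le hr).trans ?_
    -- `s² / 2 - 2 = (s - 2) (s + 2) / 2 ≥ s - 2 n` because `s ≥ 2 n ≥ 2`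
    nlinarith

end Cusp

end CHyp

theorem mainTheorem7 (n : ℕ) (hn : 1 ≤ n) (Γ : Subgroup (CHyp.PU n))
    (hlattice : CHyp.IsLattice Γ) (htf : CHyp.IsTorsionFree Γ)
    (hunip : ∀ γ ∈ Γ, CHyp.IsParabolic γ → CHyp.IsUnipotent γ)
    (d : ℝ) (hd : CHyp.IsUniformDepth Γ d) :
    (∀ s' : ℝ, s' = √2 * Real.exp (CHyp.systole Γ / 4) → 2 * n ≤ s' →
      min ((s' - 2 * n) ^ (1 / 4 : ℝ)) ((s' - 2 * n) ^ (1 / 2 : ℝ)) ≤ d) ∧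
    (4 * Real.log (5 * n + (4 * Real.pi) ^ 4) ≤ CHyp.systole Γ →
      Real.exp (CHyp.systole Γ / 16) < d ∧ 4 * Real.pi < Real.exp (CHyp.systole Γ / 16)) := by
  refine ⟨?_, fun hsys => ?_⟩
  · rintro s' rfl hs
    exact CHyp.min_rpow_le_of_isUniformDepth hn hd hs
  · have hn' : (1 : ℝ) ≤ n := by exact_mod_cast hn
    have hpi := Real.pi_pos
    set F : ℝ := Real.exp (CHyp.systole Γ / 16) with hF
    have hF0 : 0 < F := Real.exp_pos _
    have hF4 : Real.exp (CHyp.systole Γ / 4) = F ^ 4 := by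
      rw [hF, ← Real.exp_nat_mul]
      congr 1
      push_cast
      ring
    have hE : 5 * n + (4 * Real.pi) ^ 4 ≤ F ^ 4 := by
      rw [← hF4, ← Real.log_le_iff_le_exp (by positivity)]
      linarith
    have hsqrt : (1.41 : ℝ) < √2 := Real.lt_sqrt_of_sq_lt (by norm_num)
    have hpi4 : 0 < (4 * Real.pi) ^ 4 := by positivity
    -- `(√2 - 1) · 5 > 2` absorbs the term `2 n`
    have hlt : F ^ 4 < √2 * F ^ 4 - 2 * n := by nlinarith
    refine ⟨?_, lt_of_pow_lt_pow_left₀ 4 hF0.le (by linarith)⟩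
    have hmin := CHyp.min_rpow_le_of_isUniformDepth hn hd (by rw [hF4]; linarith)
    rw [hF4] at hmin
    refine lt_of_lt_of_le ?_ hmin
    set r : ℝ := √2 * F ^ 4 - 2 * n with hr
    have hr1 : 1 ≤ r := by linarith
    rw [min_eq_left (Real.rpow_le_rpow_of_exponent_le hr1 (by norm_num))]
    have h4 : (F ^ 4) ^ (1 / 4 : ℝ) = F := by
      rw [one_div]
      exact_mod_cast Real.pow_rpow_inv_natCast hF0.le (n := 4) (by norm_num)
    calc F = (F ^ 4) ^ (1 / 4 : ℝ) := h4.symm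
      _ < r ^ (1 / 4 : ℝ) := Real.rpow_lt_rpow (by positivity) hlt (by norm_num)
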